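/- Let $\mathfrak n$ be a finite-dimensional real Lie algebra with $[[\mathfrak n,\mathfrak n],\mathfrak n]=0$, let $N$ be the simply connected Lie group with Lie algebra $\mathfrak n$ (so that $\exp:\mathfrak n\to N$ is a diffeomorphism, with inverse $\log$), and let $\langle\,,\rangle$ be a nondegenerate symmetric bilinear form on $\mathfrak n$ of any signature, extended to a left-invariant pseudoriemannian metric on $N$. Let $\mathfrak z$ be the center of $\mathfrak n$ and $\mathfrak U=\mathfrak z\cap\mathfrak z^{\perp}$ its null subspace. Let $\mathfrak V$ be a null subspace complementary to $\mathfrak U$, i.e. $\langle\,,\rangle$ vanishes on $\mathfrak V$ and $\mathfrak n=(\mathfrak U\oplus\mathfrak V)\oplus(\mathfrak U^\perp\cap\mathfrak V^\perp)$; put $\mathfrak Z=\mathfrak z\cap\mathfrak U^\perp\cap\mathfrak V^\perp$ and let $\mathfrak E$ be the orthocomplement of $\mathfrak Z$ in $\mathfrak U^\perp\cap\mathfrak V^\perp$, so that $\mathfrak n=\mathfrak U\oplus\mathfrak Z\oplus\mathfrak V\oplus\mathfrak E$. Let $\Gamma\subset N$ be a lattice (a discrete subgroup with $\Gamma\backslash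 N$ compact). An element $\phi\in N$ *translates* a geodesic $\gamma:\mathbb R\to N$ by $\omega$ if $\phi\gamma(t)=\gamma(t+\omega)$ for all $t$; $\gamma$ is of unit speed if $|\langle\dot\gamma,\dot\gamma\rangle|=1$. The *period spectrum* $\mathrm{spec}_\wp(\Gamma\backslash N)$ is the union, over all nontrivial free homotopy classes $\mathcal C$ of closed curves in $\Gamma\backslash N$ (equivalently, nontrivial conjugacy classes of $\Gamma$), of the sets of periods $\omega>0$ of the periodic unit-speed geodesics of $\Gamma\backslash N$ that belong to $\mathcal C$. Suppose that $[\mathfrak n,\mathfrak n]\subseteq\mathfrak U$ and $\mathfrak E=\{0\}$. Then the period spectrum of $\Gamma\backslash N$ is computed completely from $\log\Gamma\subseteq\mathfrak n$, as follows. 1. If $\phi\in\Gamma$ translates a unit-speed geodesic $\gamma$ by $\omega$, and $\log\phi=u^*+z^*+v^*$ with $u^*\in\mathfrak U$, $z^*\in\mathfrak Z$, $v^*\in\mathfrak V$, then $$\varepsilon\,\omega^2=2\langle u^*,v^*\rangle+\langle z^*,z^*\rangle,\qquad \varepsilon=\langle\dot\gamma,\dot\gamma\rangle=\pm1 .$$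 2. $\mathrm{spec}_\wp(\Gamma\backslash N)$ is exactly the set of all $\omega>0$ for which there is an element $u^*+z^*+v^*\in\log\Gamma$ (with $u^*\in\mathfrak U$, $z^*\in\mathfrak Z$, $v^*\in\mathfrak V$) such that $\langle v^*,[v^*,y]\rangle=0$ for all $y\in\mathfrak n$ and $$\omega^2=\bigl|\,2\langle u^*,v^*\rangle+\langle z^*,z^*\rangle\,\bigr| .$$ -/

import Mathlib

set_option linter.unusedSectionVars false

/-- Two-step nilpotency of a Lie algebra: all double brackets vanish. -/
class IsTwoStepNilpotent (𝔫 : Type*) [LieRing 𝔫] : Prop where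
  lie_lie_eq_zero : ∀ x y z : 𝔫, ⁅⁅x, y⁆, z⁆ = 0

/-- The simply connected Lie group `N` with 2-step nilpotent Lie algebra `𝔫`, in exponential
coordinates: `exp : 𝔫 → N` is a diffeomorphism with inverse `log`, and the multiplication is the
Baker-Campbell-Hausdorff product `exp x * exp y = exp (x + y + (1/2) [x, y])`. -/
@[ext]
structure TwoStepGroup (𝔫 : Type*) where
  exp ::
  log : 𝔫

namespace TwoStepGroup

section Group

variable {𝔫 : Type*} [LieRing 𝔫] [LieAlgebra ℝ 𝔫] [IsTwoStepNilpotent 𝔫]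

theorem lie_lie_left (x y z : 𝔫) : ⁅⁅x, y⁆, z⁆ = 0 :=
  IsTwoStepNilpotent.lie_lie_eq_zero x y z

theorem lie_lie_right (x y z : 𝔫) : ⁅x, ⁅y, z⁆⁆ = 0 := by
  rw [← lie_skew, lie_lie_left, neg_zero]

noncomputable instance : Mul (TwoStepGroup 𝔫) where
  mul a b := exp (a.log + b.log + (1 / 2 : ℝ) • ⁅a.log, b.log⁆)

instance : One (TwoStepGroup 𝔫) where
  one := exp 0

instance : Inv (TwoStepGroup 𝔫) where
  inv a := exp (-a.log)

@[simp] theorem log_mul (a b : TwoStepGroup 𝔫) :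
    (a * b).log = a.log + b.log + (1 / 2 : ℝ) • ⁅a.log, b.log⁆ := rfl

@[simp] theorem log_one : (1 : TwoStepGroup 𝔫).log = 0 := rfl

@[simp] theorem log_inv (a : TwoStepGroup 𝔫) : a⁻¹.log = -a.log := rfl

noncomputable instance : Group (TwoStepGroup 𝔫) where
  mul_assoc a b c := by
    ext
    simp only [log_mul, lie_add, add_lie, lie_smul, smul_lie, lie_lie_left, lie_lie_right,
      smul_zero, add_zero, smul_add]
    abel
  one_mul a := by ext; simp
  mul_one a := by ext; simp
  inv_mul_cancel a := by ext; simp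

end Group

/-- `N` carries the topology of the finite-dimensional vector space `𝔫`. -/
instance {𝔫 : Type*} [TopologicalSpace 𝔫] : TopologicalSpace (TwoStepGroup 𝔫) :=
  TopologicalSpace.induced log inferInstance

section Lattice

variable {𝔫 : Type*} [LieRing 𝔫] [LieAlgebra ℝ 𝔫] [IsTwoStepNilpotent 𝔫] [TopologicalSpace 𝔫]

/-- The space `Γ \ N` of orbits of `Γ` acting on `N` by left translations. -/
abbrev Nilmanifold (Γ : Subgroup (TwoStepGroup 𝔫)) : Type _ :=
  Quotient (MulAction.orbitRel Γ (TwoStepGroup 𝔫))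

/-- The natural projection `N → Γ \ N`. -/
noncomputable def proj (Γ : Subgroup (TwoStepGroup 𝔫)) (n : TwoStepGroup 𝔫) : Nilmanifold Γ :=
  Quotient.mk (MulAction.orbitRel Γ (TwoStepGroup 𝔫)) n

/-- A lattice: a discrete subgroup with compact quotient `Γ \ N`. -/
structure IsLattice (Γ : Subgroup (TwoStepGroup 𝔫)) : Prop where
  discrete : DiscreteTopology Γ
  cocompact : CompactSpace (Nilmanifold Γ)

/-- The subset `log Γ` of `𝔫`. -/
def logSet (Γ : Subgroup (TwoStepGroup 𝔫)) : Set 𝔫 :=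
  TwoStepGroup.log '' (Γ : Set (TwoStepGroup 𝔫))

end Lattice

section Metric

variable {𝔫 : Type*} [LieRing 𝔫] [LieAlgebra ℝ 𝔫] [IsTwoStepNilpotent 𝔫]

/-- The inverse of the differential of left translation by `exp p`, in exponential coordinates. -/
noncomputable def pullBack (p a : 𝔫) : 𝔫 := a - (1 / 2 : ℝ) • ⁅p, a⁆

/-- Left translation by `exp p` is affine in exponential coordinates, with differential
`a ↦ a + (1/2) [p, a]` everywhere. -/
theorem log_exp_mul_exp (p x a : 𝔫) :
    (exp p * exp (x + a)).log = (exp p * exp x).log + (a + (1 / 2 : ℝ) • ⁅p, a⁆) := by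
  simp only [log_mul, lie_add, smul_add]
  abel

theorem pullBack_leftTranslation (p a : 𝔫) : pullBack p (a + (1 / 2 : ℝ) • ⁅p, a⁆) = a := by
  simp [pullBack, lie_add, lie_smul, lie_lie_right]

/-- The left-invariant metric tensor on `N` whose value at the identity is `B`: the inner product
of the tangent vectors with coordinate expressions `a`, `b` at the point `exp p`. -/
noncomputable def metric (B : LinearMap.BilinForm ℝ 𝔫) (p a b : 𝔫) : ℝ :=
  B (pullBack p a) (pullBack p b)

/-- The Christoffel symbol of the first kind of the metric tensor in exponential coordinates:
`(1/2) (∂_a g(b, w) + ∂_b g(a, w) - ∂_w g(a, b))`. -/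
noncomputable def christoffel (B : LinearMap.BilinForm ℝ 𝔫) (p a b w : 𝔫) : ℝ :=
  (1 / 2 : ℝ) *
    (lineDeriv ℝ (fun q => metric B q b w) p a + lineDeriv ℝ (fun q => metric B q a w) p b
      - lineDeriv ℝ (fun q => metric B q a b) p w)

variable [TopologicalSpace 𝔫] [IsTopologicalAddGroup 𝔫] [ContinuousSMul ℝ 𝔫]

/-- The coordinate expression of the velocity of a curve in `N`. -/
noncomputable def velocity (γ : ℝ → TwoStepGroup 𝔫) : ℝ → 𝔫 :=
  deriv (fun t => (γ t).log)

/-- Geodesics of the Levi-Civita connection, defined on all of `ℝ`, in exponential coordinates: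
`g(γ'', w) + Γ(γ', γ', w) = 0` for all `w`. -/
structure IsGeodesic (B : LinearMap.BilinForm ℝ 𝔫) (γ : ℝ → TwoStepGroup 𝔫) : Prop where
  differentiable : Differentiable ℝ (fun t => (γ t).log)
  differentiable_velocity : Differentiable ℝ (velocity γ)
  equation : ∀ (t : ℝ) (w : 𝔫),
    metric B (γ t).log (deriv (velocity γ) t) w
      + christoffel B (γ t).log (velocity γ t) (velocity γ t) w = 0

/-- The inner product `⟨γ'(t), γ'(t)⟩`. -/
noncomputable def speedSq (B : LinearMap.BilinForm ℝ 𝔫) (γ : ℝ → TwoStepGroup 𝔫) (t : ℝ) : ℝ :=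
  metric B (γ t).log (velocity γ t) (velocity γ t)

structure IsUnitSpeedGeodesic (B : LinearMap.BilinForm ℝ 𝔫) (γ : ℝ → TwoStepGroup 𝔫) : Prop
    extends IsGeodesic B γ where
  unit_speed : ∀ t, |speedSq B γ t| = 1

/-- `φ` translates the curve `γ` by `ω`. -/
def Translates (φ : TwoStepGroup 𝔫) (γ : ℝ → TwoStepGroup 𝔫) (ω : ℝ) : Prop :=
  ∀ t, φ * γ t = γ (t + ω)

/-- The periods of the periodic unit-speed geodesics of `Γ \ N` that belong to the free homotopy
class of closed curves corresponding to the conjugacy class `C` of `Γ`. The projection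
`N → Γ \ N` is the universal covering and a local isometry, so that the geodesics of `Γ \ N` are
the projections of the geodesics `γ` of `N`; the closed curve obtained from the restriction to
`[0, ω]` belongs to the class of the `φ ∈ Γ` with `γ(ω) = φ γ(0)`. -/
def periods (B : LinearMap.BilinForm ℝ 𝔫) (Γ : Subgroup (TwoStepGroup 𝔫)) (C : ConjClasses Γ) :
    Set ℝ :=
  {ω | 0 < ω ∧ ∃ γ : ℝ → TwoStepGroup 𝔫, IsUnitSpeedGeodesic B γ ∧
    Function.Periodic (fun t => proj Γ (γ t)) ω ∧
    ∃ φ : Γ, ConjClasses.mk φ = C ∧ γ ω = (φ : TwoStepGroup 𝔫) * γ 0}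

/-- The period spectrum of `Γ \ N`: the union of the sets of periods over all nontrivial
classes. -/
def periodSpectrum (B : LinearMap.BilinForm ℝ 𝔫) (Γ : Subgroup (TwoStepGroup 𝔫)) : Set ℝ :=
  ⋃ (C : ConjClasses Γ) (_ : C ≠ ConjClasses.mk 1), periods B Γ C

end Metric

section Decomposition

variable {𝔫 : Type*} [LieRing 𝔫] [LieAlgebra ℝ 𝔫]

/-- The center of the Lie algebra, as a linear subspace. -/
def centerSubspace (𝔫 : Type*) [LieRing 𝔫] [LieAlgebra ℝ 𝔫] : Submodule ℝ 𝔫 :=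
  (LieAlgebra.center ℝ 𝔫).toSubmodule

/-- `𝔘`, the null subspace of the center: the radical of the inner product on the center. -/
def subU (B : LinearMap.BilinForm ℝ 𝔫) : Submodule ℝ 𝔫 :=
  centerSubspace 𝔫 ⊓ B.orthogonal (centerSubspace 𝔫)

/-- `𝔙` is an admissible choice of a null subspace complementary to `𝔘`: it is null, and
`𝔫` is the direct sum of `𝔘 + 𝔙` and `𝔘^⊥ ∩ 𝔙^⊥` (in particular `𝔘 ∩ 𝔙 = 0`, since a vector of
`𝔘 ∩ 𝔙` is orthogonal to `𝔘` and to `𝔙`). -/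
structure IsNullComplement (B : LinearMap.BilinForm ℝ 𝔫) (V : Submodule ℝ 𝔫) : Prop where
  null : ∀ v ∈ V, ∀ w ∈ V, B v w = 0
  isCompl : IsCompl (subU B ⊔ V) (B.orthogonal (subU B) ⊓ B.orthogonal V)

/-- `ℨ`, the portion of the center in `𝔘^⊥ ∩ 𝔙^⊥`. -/
def subZ (B : LinearMap.BilinForm ℝ 𝔫) (V : Submodule ℝ 𝔫) : Submodule ℝ 𝔫 :=
  centerSubspace 𝔫 ⊓ (B.orthogonal (subU B) ⊓ B.orthogonal V)

/-- `𝔈`, the orthocomplement of `ℨ` in `𝔘^⊥ ∩ 𝔙^⊥`. -/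
def subE (B : LinearMap.BilinForm ℝ 𝔫) (V : Submodule ℝ 𝔫) : Submodule ℝ 𝔫 :=
  (B.orthogonal (subU B) ⊓ B.orthogonal V) ⊓ B.orthogonal (subZ B V)

end Decomposition

end TwoStepGroup

/-! With 𝔈 = 0 the orthogonal complement of the center is 𝔘 (`orthogonal_center_eq_subU`), and
brackets, lying in 𝔘, are orthogonal to the center. The geodesic equation then reduces to ⟨γ'', w⟩ =
⟨γ', [γ', w]⟩ with γ'' in 𝔘. The right side sees γ' only modulo the center, where γ' is constant, so
γ'' is a constant c and γ is quadratic (`IsGeodesic.exists_quadratic`).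

If φ translates γ by ω, then log φ ≡ ω γ'(0) modulo 𝔘 and ω c = 0; hence ⟨log φ, [log φ, y]⟩ = 0 and
ε ω² = ⟨log φ, log φ⟩ (`translates_invariants`). Conversely, these conditions make t ↦ exp(t ω⁻¹ log
φ) a unit-speed geodesic translated by φ. -/

/-- Only a vector topology is given, no norm; pairing with functionals turns the geodesic equation
into real ODEs. -/
theorem hasDerivAt_continuousLinearMap_comp {E : Type*} [AddCommGroup E] [Module ℝ E]
    [TopologicalSpace E] [IsTopologicalAddGroup E] [ContinuousSMul ℝ E]
    (L : E →L[ℝ] ℝ) {f : ℝ → E} {t : ℝ} (hf : DifferentiableAt ℝ f t) :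
    HasDerivAt (fun s => L (f s)) (L (deriv f t)) t := by
  have h := hf.hasFDerivAt.isLittleOTVS
  have h2 : HasFDerivAt (fun s => L (f s)) (L.comp (fderiv ℝ f t)) t :=
    .of_isLittleOTVS (((L.isBigOTVS_comp).trans_isLittleOTVS h).congr_left fun x => by simp)
  exact h2.hasDerivAt

theorem eq_add_mul_of_hasDerivAt_const {f : ℝ → ℝ} {c : ℝ} (hf : ∀ t, HasDerivAt f c t) (t : ℝ) :
    f t = f 0 + t * c := by
  have h : ∀ s, HasDerivAt (fun s => f s - s * c) (c - 1 * c) s := fun s =>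
    (hf s).sub ((hasDerivAt_id s).mul_const c)
  have := is_const_of_deriv_eq_zero (fun s => (h s).differentiableAt)
    (fun s => by rw [(h s).deriv]; ring) t 0
  simp only [zero_mul] at this
  linarith

theorem eq_quadratic_of_hasDerivAt {f : ℝ → ℝ} {a c : ℝ}
    (hf : ∀ t, HasDerivAt f (a + t * c) t) (t : ℝ) :
    f t = f 0 + t * a + t ^ 2 / 2 * c := by
  have h : ∀ s, HasDerivAt (fun s => f s - s ^ 2 / 2 * c) a s := fun s => by
    have := (hf s).sub ((((hasDerivAt_id s).pow 2).div_const 2).mul_const c)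
    exact this.congr_deriv (by simp)
  have := eq_add_mul_of_hasDerivAt_const h t
  linarith

namespace TwoStepGroup

/-! ### Orthogonality relations among the center, 𝔘, ℨ and 𝔙. -/

section Algebra

variable {𝔫 : Type*} [LieRing 𝔫] [LieAlgebra ℝ 𝔫] {B : LinearMap.BilinForm ℝ 𝔫}

theorem mem_centerSubspace {x : 𝔫} : x ∈ centerSubspace 𝔫 ↔ ∀ y : 𝔫, ⁅y, x⁆ = 0 :=
  LieModule.mem_maxTrivSubmodule (R := ℝ) (L := 𝔫) (M := 𝔫) x

theorem lie_eq_zero_of_mem_center {x : 𝔫} (hx : x ∈ centerSubspace 𝔫) (y : 𝔫) : ⁅x, y⁆ = 0 := by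
  rw [← lie_skew, mem_centerSubspace.1 hx, neg_zero]

theorem subU_le_orthogonal_center : subU B ≤ B.orthogonal (centerSubspace 𝔫) := inf_le_right

theorem form_center_lie (hU : ∀ x y : 𝔫, ⁅x, y⁆ ∈ subU B) {w : 𝔫} (hw : w ∈ centerSubspace 𝔫)
    (x y : 𝔫) : B w ⁅x, y⁆ = 0 :=
  (hU x y).2 w hw

theorem lie_mem_center (hU : ∀ x y : 𝔫, ⁅x, y⁆ ∈ subU B) (x y : 𝔫) :
    ⁅x, y⁆ ∈ centerSubspace 𝔫 := (hU x y).1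

/-- Write y = u + v + e. Pairing with 𝔘 puts the null part v in (𝔘 + 𝔙) ∩ 𝔘^⊥ ∩ 𝔙^⊥ = 0; pairing
with ℨ then puts e in 𝔈 = 0. -/
theorem orthogonal_center_eq_subU {V : Submodule ℝ 𝔫}
    (hV : IsNullComplement B V) (hE : subE B V = ⊥) :
    B.orthogonal (centerSubspace 𝔫) = subU B := by
  refine le_antisymm (fun y hy => ?_) subU_le_orthogonal_center
  have hy' : ∀ n ∈ centerSubspace 𝔫, B n y = 0 := hy
  obtain ⟨a, ha, e, he, rfl⟩ := Submodule.mem_sup.1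
    (show y ∈ (subU B ⊔ V) ⊔ (B.orthogonal (subU B) ⊓ B.orthogonal V) by
      rw [hV.isCompl.sup_eq_top]; trivial)
  obtain ⟨u, hu, v, hv, rfl⟩ := Submodule.mem_sup.1 ha
  have heU : ∀ n ∈ subU B, B n e = 0 := he.1
  have hUU : ∀ n ∈ subU B, B n u = 0 := fun n hn => hu.2 n hn.1
  have hv0 : v = 0 := by
    have : v ∈ (subU B ⊔ V) ⊓ (B.orthogonal (subU B) ⊓ B.orthogonal V) := by
      refine ⟨Submodule.mem_sup_right hv, fun n hn => ?_, fun n hn => hV.null n hn v hv⟩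
      have h := hy' n hn.1
      rw [map_add, map_add, heU n hn, hUU n hn] at h
      simpa using h
    rw [hV.isCompl.inf_eq_bot] at this
    simpa using this
  have he0 : e = 0 := by
    have : e ∈ subE B V := by
      refine ⟨he, fun n hn => ?_⟩
      have h := hy' n hn.1
      rw [map_add, map_add, hv0, hu.2 n hn.1] at h
      simpa using h
    rw [hE] at this
    simpa using this
  simpa [hv0, he0] using hu

theorem exists_decomposition [FiniteDimensional ℝ 𝔫] (hsymm : B.IsSymm) (hnondeg : B.Nondegenerate)
    {V : Submodule ℝ 𝔫} (hV : IsNullComplement B V) (hE : subE B V = ⊥) (x : 𝔫) :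
    ∃ u ∈ subU B, ∃ z ∈ subZ B V, ∃ v ∈ V, x = u + z + v := by
  obtain ⟨a, ha, z, hz, rfl⟩ := Submodule.mem_sup.1
    (show x ∈ (subU B ⊔ V) ⊔ (B.orthogonal (subU B) ⊓ B.orthogonal V) by
      rw [hV.isCompl.sup_eq_top]; trivial)
  obtain ⟨u, hu, v, hv, rfl⟩ := Submodule.mem_sup.1 ha
  refine ⟨u, hu, z, ⟨?_, hz⟩, v, hv, by abel⟩
  -- Taking complements once more gives 𝔘^⊥ = 𝔷, so the component in 𝔘^⊥ ∩ 𝔙^⊥ is central.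
  have hc := LinearMap.BilinForm.orthogonal_orthogonal hnondeg hsymm.isRefl (centerSubspace 𝔫)
  rw [orthogonal_center_eq_subU hV hE] at hc
  rw [← hc]
  exact hz.1

theorem form_decomposition_self (hsymm : B.IsSymm) {V : Submodule ℝ 𝔫}
    (hV : IsNullComplement B V) {u z v : 𝔫} (hu : u ∈ subU B) (hz : z ∈ subZ B V) (hv : v ∈ V) :
    B (u + z + v) (u + z + v) = 2 * B u v + B z z := by
  have h1 : B u u = 0 := hu.2 u hu.1
  have h2 : B z u = 0 := hu.2 z hz.1
  have h3 : B u z = 0 := by rw [hsymm.eq u z]; exact h2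
  have h4 : B v v = 0 := hV.null v hv v hv
  have h5 : B v z = 0 := hz.2.2 v hv
  have h6 : B z v = 0 := by rw [hsymm.eq z v]; exact h5
  have h7 : B v u = B u v := hsymm.eq v u
  simp only [map_add, LinearMap.add_apply]
  linarith

theorem form_lie_decomposition (hU : ∀ x y : 𝔫, ⁅x, y⁆ ∈ subU B) {V : Submodule ℝ 𝔫}
    {u z v : 𝔫} (hu : u ∈ subU B) (hz : z ∈ subZ B V) (y : 𝔫) :
    B (u + z + v) ⁅u + z + v, y⁆ = B v ⁅v, y⁆ := by
  simp only [map_add, LinearMap.add_apply, add_lie, lie_eq_zero_of_mem_center hu.1,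
    lie_eq_zero_of_mem_center hz.1, form_center_lie hU hu.1, form_center_lie hU hz.1, zero_add]

end Algebra

/-! ### The metric in exponential coordinates, geodesics and their translations. -/

section Geodesics

variable {𝔫 : Type*} [LieRing 𝔫] [LieAlgebra ℝ 𝔫] [IsTwoStepNilpotent 𝔫]
  {B : LinearMap.BilinForm ℝ 𝔫}

/-- The term quadratic in p pairs two brackets and vanishes, so the metric is affine in p and the
Christoffel symbols are constant. -/
theorem metric_eq (hU : ∀ x y : 𝔫, ⁅x, y⁆ ∈ subU B) (p a b : 𝔫) :
    metric B p a b = B a b - 1 / 2 * (B ⁅p, a⁆ b + B a ⁅p, b⁆) := by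
  have h : B ⁅p, a⁆ ⁅p, b⁆ = 0 := form_center_lie hU (lie_mem_center hU p a) p b
  simp only [metric, pullBack, map_sub, map_smul, LinearMap.sub_apply, LinearMap.smul_apply, h,
    smul_eq_mul]
  ring

theorem lineDeriv_metric (hU : ∀ x y : 𝔫, ⁅x, y⁆ ∈ subU B) (p a b d : 𝔫) :
    lineDeriv ℝ (fun q => metric B q a b) p d = -(1 / 2) * (B ⁅d, a⁆ b + B a ⁅d, b⁆) := by
  have h : (fun t : ℝ => metric B (p + t • d) a b) =
      fun t => metric B p a b + t * (-(1 / 2) * (B ⁅d, a⁆ b + B a ⁅d, b⁆)) := by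
    funext t
    simp only [metric_eq hU, add_lie, smul_lie, map_add, map_smul, LinearMap.add_apply,
      LinearMap.smul_apply, smul_eq_mul]
    ring
  rw [lineDeriv, h]
  simp

theorem christoffel_self (hsymm : B.IsSymm) (hU : ∀ x y : 𝔫, ⁅x, y⁆ ∈ subU B) (p x w : 𝔫) :
    christoffel B p x x w = -B x ⁅x, w⁆ := by
  have h1 : B ⁅w, x⁆ x = -B x ⁅x, w⁆ := by rw [hsymm.eq ⁅w, x⁆ x, ← lie_skew, map_neg]
  have h2 : B x ⁅w, x⁆ = -B x ⁅x, w⁆ := by rw [← lie_skew, map_neg]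
  simp only [christoffel, lineDeriv_metric hU, lie_self, h1, h2, map_zero, LinearMap.zero_apply]
  ring

variable [TopologicalSpace 𝔫] [IsTopologicalAddGroup 𝔫] [ContinuousSMul ℝ 𝔫]

/-- A geodesic is a quadratic curve in exponential coordinates when `[𝔫, 𝔫] ⊆ 𝔘` and the
orthogonal complement of the center is `𝔘`. -/
theorem IsGeodesic.exists_quadratic [FiniteDimensional ℝ 𝔫] [T2Space 𝔫] (hsymm : B.IsSymm)
    (hnondeg : B.Nondegenerate) (hU : ∀ x y : 𝔫, ⁅x, y⁆ ∈ subU B)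
    (hperp : B.orthogonal (centerSubspace 𝔫) = subU B) {γ : ℝ → TwoStepGroup 𝔫}
    (hγ : IsGeodesic B γ) :
    ∃ p x c : 𝔫, c ∈ subU B ∧ (∀ w, B c w = B x ⁅x, w⁆) ∧
      (∀ t, (γ t).log = p + t • x + (t ^ 2 / 2) • c) ∧ (∀ t, velocity γ t = x + t • c) := by
  have heq : ∀ t w, metric B (γ t).log (deriv (velocity γ) t) w
      = B (velocity γ t) ⁅velocity γ t, w⁆ := fun t w => by
    have := hγ.equation t w
    rw [christoffel_self hsymm hU] at this
    linarith
  -- Testing against central w kills every bracket term.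
  have hacc : ∀ t, deriv (velocity γ) t ∈ subU B := fun t => by
    rw [← hperp]
    intro w hw
    have := heq t w
    rw [metric_eq hU, mem_centerSubspace.1 hw, mem_centerSubspace.1 hw, hsymm.eq ⁅_, _⁆ w,
      form_center_lie hU hw, hsymm.eq _ w] at this
    simpa using this
  have hacc' : ∀ t w, B w (deriv (velocity γ) t) = B (velocity γ t) ⁅velocity γ t, w⁆ :=
    fun t w => by
      have := heq t w
      rw [metric_eq hU, mem_centerSubspace.1 (hacc t).1, form_center_lie hU (hacc t).1,
        hsymm.eq _ w] at this
      simpa using this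
  let L : 𝔫 → 𝔫 →L[ℝ] ℝ := fun w => LinearMap.toContinuousLinearMap (B w)
  have hd1 : ∀ w t, HasDerivAt (fun s => B w (γ s).log) (B w (velocity γ t)) t := fun w t =>
    hasDerivAt_continuousLinearMap_comp (L w) (hγ.differentiable t)
  have hd2 : ∀ w t, HasDerivAt (fun s => B w (velocity γ s)) (B w (deriv (velocity γ) t)) t :=
    fun w t => hasDerivAt_continuousLinearMap_comp (L w) (hγ.differentiable_velocity t)
  have hsub : ∀ t, velocity γ t - velocity γ 0 ∈ subU B := fun t => by
    rw [← hperp]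
    intro w hw
    have := eq_add_mul_of_hasDerivAt_const (fun s => (hd2 w s).congr_deriv ((hacc s).2 w hw)) t
    change B w (velocity γ t - velocity γ 0) = 0
    rw [map_sub, this]
    ring
  have hconst : ∀ t w, B (velocity γ t) ⁅velocity γ t, w⁆
      = B (velocity γ 0) ⁅velocity γ 0, w⁆ := fun t w => by
    obtain ⟨e, he⟩ : ∃ e, e = velocity γ t - velocity γ 0 := ⟨_, rfl⟩
    have hx : velocity γ t = velocity γ 0 + e := by rw [he]; abel
    have heU : e ∈ subU B := he ▸ hsub t
    rw [hx, add_lie, lie_eq_zero_of_mem_center heU.1, add_zero, map_add, LinearMap.add_apply,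
      form_center_lie hU heU.1, add_zero]
  have hv : ∀ w t, B w (velocity γ t) = B w (velocity γ 0) + t * B w (deriv (velocity γ) 0) :=
    fun w t => eq_add_mul_of_hasDerivAt_const (fun s => (hd2 w s).congr_deriv (by
      rw [hacc', hacc', hconst])) t
  refine ⟨(γ 0).log, velocity γ 0, deriv (velocity γ) 0, hacc 0, fun w => ?_, fun t => ?_,
    fun t => ?_⟩
  · rw [← hacc', hsymm.eq _ w]
  · refine sub_eq_zero.1 (hnondeg.2 _ fun w => ?_)
    have := eq_quadratic_of_hasDerivAt (fun s => (hd1 w s).congr_deriv (hv w s)) t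
    simp only [map_sub, map_add, map_smul, smul_eq_mul, this]
    ring
  · refine sub_eq_zero.1 (hnondeg.2 _ fun w => ?_)
    simp only [map_sub, map_add, map_smul, smul_eq_mul, hv w t]
    ring

/-- Both sides of the translation identity are polynomials in t with equal t² terms; t = 0 and t = 1
isolate the other two coefficients. -/
theorem smul_lie_eq_zero_and_log_of_translates {φ : TwoStepGroup 𝔫} {γ : ℝ → TwoStepGroup 𝔫}
    {ω : ℝ} {p x c : 𝔫} (hc : c ∈ centerSubspace 𝔫)
    (hγ : ∀ t, (γ t).log = p + t • x + (t ^ 2 / 2) • c) (h : Translates φ γ ω) :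
    (1 / 2 : ℝ) • ⁅φ.log, x⁆ = ω • c ∧
      φ.log + (1 / 2 : ℝ) • ⁅φ.log, p⁆ = ω • x + (ω ^ 2 / 2) • c := by
  have key : ∀ t : ℝ, φ.log + (p + t • x + (t ^ 2 / 2) • c) +
      (1 / 2 : ℝ) • (⁅φ.log, p⁆ + t • ⁅φ.log, x⁆) =
      p + (t + ω) • x + ((t + ω) ^ 2 / 2) • c := fun t => by
    have := congrArg TwoStepGroup.log (h t)
    rw [log_mul, hγ, hγ, lie_add, lie_add, lie_smul, lie_smul, mem_centerSubspace.1 hc,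
      smul_zero, add_zero] at this
    exact this
  have h0 : φ.log + (1 / 2 : ℝ) • ⁅φ.log, p⁆ = ω • x + (ω ^ 2 / 2) • c := by
    linear_combination (norm := module) key 0
  refine ⟨?_, h0⟩
  linear_combination (norm := module) key 1 - h0

/-- The acceleration of a geodesic translated by a nonzero amount vanishes, and the translating
element determines its speed. -/
theorem translates_invariants (hsymm : B.IsSymm) (hU : ∀ x y : 𝔫, ⁅x, y⁆ ∈ subU B)
    {φ : TwoStepGroup 𝔫} {γ : ℝ → TwoStepGroup 𝔫} {ω : ℝ} {p x c : 𝔫} (hc : c ∈ subU B)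
    (hcw : ∀ w, B c w = B x ⁅x, w⁆)
    (hγ : ∀ t, (γ t).log = p + t • x + (t ^ 2 / 2) • c) (hv : ∀ t, velocity γ t = x + t • c)
    (h : Translates φ γ ω) :
    (∀ t, speedSq B γ t * ω ^ 2 = B φ.log φ.log) ∧ ∀ y, B φ.log ⁅φ.log, y⁆ = 0 := by
  obtain ⟨h1, h2⟩ := smul_lie_eq_zero_and_log_of_translates hc.1 hγ h
  obtain ⟨f, hf⟩ : ∃ f : 𝔫, f = φ.log := ⟨_, rfl⟩
  rw [← hf] at h1 h2 ⊢
  have hfx : f = ω • x + ((ω ^ 2 / 2) • c - (1 / 2 : ℝ) • ⁅f, p⁆) := by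
    rw [← add_sub_assoc, ← h2]; abel
  have hcen : (ω ^ 2 / 2) • c - (1 / 2 : ℝ) • ⁅f, p⁆ ∈ subU B :=
    sub_mem (Submodule.smul_mem _ _ hc) (Submodule.smul_mem _ _ (hU _ _))
  -- Modulo the center f is ω x, so [f, x] = 0.
  have hωc : ω • c = 0 := by
    rw [← h1, hfx, add_lie, smul_lie, lie_self, lie_eq_zero_of_mem_center hcen.1]
    simp
  have hx0 : ∀ w, ω * B x ⁅x, w⁆ = 0 := fun w => by
    rw [← hcw, ← smul_eq_mul, ← LinearMap.smul_apply, ← map_smul, hωc, map_zero,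
      LinearMap.zero_apply]
  have hlie : ∀ y : 𝔫, ⁅f, y⁆ = ω • ⁅x, y⁆ := fun y => by
    rw [hfx, add_lie, smul_lie, lie_eq_zero_of_mem_center hcen.1, add_zero]
  have hB : ∀ y, B f ⁅f, y⁆ = 0 := fun y => by
    rw [hlie, hfx]
    simp only [map_add, map_smul, LinearMap.add_apply, LinearMap.smul_apply, smul_eq_mul,
      form_center_lie hU hcen.1]
    linear_combination ω * hx0 y
  refine ⟨fun t => ?_, hB⟩
  have hvel : ω • velocity γ t = f + (1 / 2 : ℝ) • ⁅f, p⁆ := by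
    rw [hv, h2, smul_add, smul_comm ω t c, hωc, smul_zero, pow_two, mul_div_assoc, mul_comm,
      mul_smul, hωc, smul_zero]
  -- Scaling the velocity by ω avoids dividing by ω, which may be zero here.
  have hscale : speedSq B γ t * ω ^ 2 =
      metric B (γ t).log (ω • velocity γ t) (ω • velocity γ t) := by
    simp only [speedSq, metric, pullBack, lie_smul, map_sub, map_smul, LinearMap.sub_apply,
      LinearMap.smul_apply, smul_eq_mul]
    ring
  have hfl : ∀ q : 𝔫, B f ⁅q, f⁆ = 0 := fun q => by rw [← lie_skew, map_neg, hB, neg_zero]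
  have hfs : ∀ q r : 𝔫, B ⁅q, r⁆ f = B f ⁅q, r⁆ := fun q r => hsymm.eq _ _
  have hll : ∀ q r s t : 𝔫, B ⁅q, r⁆ ⁅s, t⁆ = 0 := fun q r s t =>
    form_center_lie hU (lie_mem_center hU q r) s t
  rw [hscale, hvel, metric_eq hU]
  simp only [lie_add, lie_smul, lie_lie_right, smul_zero, add_zero, map_add, map_smul,
    LinearMap.add_apply, LinearMap.smul_apply, smul_eq_mul, hfs, hfl, hB, hll, mul_zero, sub_zero]

theorem velocity_exp_smul [T2Space 𝔫] (x : 𝔫) :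
    velocity (fun t : ℝ => exp (t • x)) = fun _ => x := by
  funext t
  have h := ((ContinuousLinearMap.toSpanSingleton ℝ x).hasFDerivAt (x := t)).fderiv
  have h' := congrArg (fun T : ℝ →L[ℝ] 𝔫 => T 1) h
  rw [ContinuousLinearMap.toSpanSingleton_apply, one_smul] at h'
  exact h'

theorem speedSq_exp_smul [T2Space 𝔫] (x : 𝔫) (t : ℝ) :
    speedSq B (fun t : ℝ => exp (t • x)) t = B x x := by
  simp [speedSq, velocity_exp_smul, metric, pullBack]

/-- The one-parameter subgroup `t ↦ exp (t x)` is a geodesic if `⟨x, [x, y]⟩ = 0` for all `y`. -/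
theorem isGeodesic_exp_smul [T2Space 𝔫] (hsymm : B.IsSymm) (hU : ∀ x y : 𝔫, ⁅x, y⁆ ∈ subU B)
    {x : 𝔫} (hx : ∀ y, B x ⁅x, y⁆ = 0) : IsGeodesic B (fun t => exp (t • x)) where
  differentiable := (ContinuousLinearMap.toSpanSingleton ℝ x).differentiable
  differentiable_velocity := by
    rw [velocity_exp_smul]
    exact differentiable_const x
  equation t w := by
    rw [velocity_exp_smul, christoffel_self hsymm hU, hx]
    have h : deriv (fun _ : ℝ => x) t = 0 := by
      rw [deriv, (hasFDerivAt_const x t).fderiv, zero_apply]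
    simp [h, metric, pullBack]

theorem translates_exp_smul (x : 𝔫) (ω : ℝ) :
    Translates (exp (ω • x)) (fun t => exp (t • x)) ω := by
  intro t
  ext
  simp only [log_mul, lie_smul, smul_lie, lie_self, smul_zero, add_zero, add_smul]
  abel

theorem proj_eq_iff {Γ : Subgroup (TwoStepGroup 𝔫)} {a b : TwoStepGroup 𝔫} :
    proj Γ a = proj Γ b ↔ ∃ g ∈ Γ, g * b = a := by
  rw [proj, proj, Quotient.eq, MulAction.orbitRel_apply, MulAction.mem_orbit_iff]
  exact ⟨fun ⟨g, hg⟩ => ⟨g, g.2, hg⟩, fun ⟨g, hg, h⟩ => ⟨⟨g, hg⟩, h⟩⟩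

/-- A continuous path in `N` whose projection to `Γ \ N` is periodic is translated by the deck
transformation relating the values at `0` and at the period. -/
theorem translates_of_periodic {Γ : Subgroup (TwoStepGroup 𝔫)} [DiscreteTopology Γ]
    {γ : ℝ → TwoStepGroup 𝔫} {ω : ℝ} {p x c : 𝔫}
    (hγ : ∀ t, (γ t).log = p + t • x + (t ^ 2 / 2) • c)
    (hper : Function.Periodic (fun t => proj Γ (γ t)) ω) {φ : TwoStepGroup 𝔫}
    (hφ : γ ω = φ * γ 0) : Translates φ γ ω := by
  have hmem : ∀ t, γ (t + ω) * (γ t)⁻¹ ∈ Γ := fun t => by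
    obtain ⟨g, hg, h⟩ := proj_eq_iff.1 (hper t)
    rwa [← h, mul_inv_cancel_right]
  -- A continuous map from the connected line to the discrete Γ is constant.
  have hcont : Continuous fun t => (⟨γ (t + ω) * (γ t)⁻¹, hmem t⟩ : Γ) := by
    refine Continuous.subtype_mk (continuous_induced_rng.2 ?_) _
    simp only [Function.comp_def, log_mul, log_inv, hγ, lie_add, add_lie, lie_neg, lie_smul,
      smul_lie]
    fun_prop
  intro t
  have h := congrArg Subtype.val
    (PreconnectedSpace.constant (inferInstance : PreconnectedSpace ℝ) hcont (x := t) (y := 0))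
  simp only [zero_add, hφ, mul_inv_cancel_right] at h
  rw [← h, inv_mul_cancel_right]

end Geodesics

end TwoStepGroup

theorem mainTheorem10
    {𝔫 : Type*} [LieRing 𝔫] [LieAlgebra ℝ 𝔫] [FiniteDimensional ℝ 𝔫] [IsTwoStepNilpotent 𝔫]
    [TopologicalSpace 𝔫] [IsTopologicalAddGroup 𝔫] [ContinuousSMul ℝ 𝔫] [T2Space 𝔫]
    (B : LinearMap.BilinForm ℝ 𝔫) (hsymm : B.IsSymm) (hnondeg : B.Nondegenerate)
    (V : Submodule ℝ 𝔫) (hV : TwoStepGroup.IsNullComplement B V)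
    (hU : ∀ x y : 𝔫, ⁅x, y⁆ ∈ TwoStepGroup.subU B)
    (hE : TwoStepGroup.subE B V = ⊥)
    (Γ : Subgroup (TwoStepGroup 𝔫)) (hΓ : TwoStepGroup.IsLattice Γ) :
    (∀ φ : TwoStepGroup 𝔫, φ ∈ Γ →
      ∀ γ : ℝ → TwoStepGroup 𝔫, TwoStepGroup.IsUnitSpeedGeodesic B γ →
      ∀ ω : ℝ, TwoStepGroup.Translates φ γ ω →
      ∃ u ∈ TwoStepGroup.subU B, ∃ z ∈ TwoStepGroup.subZ B V, ∃ v ∈ V,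
        φ.log = u + z + v ∧
        ∀ t : ℝ, TwoStepGroup.speedSq B γ t * ω ^ 2 = 2 * B u v + B z z) ∧
    TwoStepGroup.periodSpectrum B Γ =
      {ω : ℝ | 0 < ω ∧
        ∃ u ∈ TwoStepGroup.subU B, ∃ z ∈ TwoStepGroup.subZ B V, ∃ v ∈ V,
          u + z + v ∈ TwoStepGroup.logSet Γ ∧
          (∀ y : 𝔫, B v ⁅v, y⁆ = 0) ∧
          ω ^ 2 = |2 * B u v + B z z|} := by
  have hperp := TwoStepGroup.orthogonal_center_eq_subU hV hE
  have := hΓ.discrete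
  refine ⟨fun φ _ γ hγ ω h => ?_, Set.ext fun ω => ⟨fun hω => ?_, ?_⟩⟩
  · obtain ⟨p, x, c, hc, hcw, hlog, hvel⟩ :=
      hγ.toIsGeodesic.exists_quadratic hsymm hnondeg hU hperp
    obtain ⟨u, hu, z, hz, v, hv, hφ⟩ :=
      TwoStepGroup.exists_decomposition hsymm hnondeg hV hE φ.log
    refine ⟨u, hu, z, hz, v, hv, hφ, fun t => ?_⟩
    rw [(TwoStepGroup.translates_invariants hsymm hU hc hcw hlog hvel h).1 t, hφ,
      TwoStepGroup.form_decomposition_self hsymm hV hu hz hv]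
  · simp only [TwoStepGroup.periodSpectrum, Set.mem_iUnion] at hω
    obtain ⟨C, -, hpos, γ, hγ, hper, φ, -, hφγ⟩ := hω
    obtain ⟨p, x, c, hc, hcw, hlog, hvel⟩ :=
      hγ.toIsGeodesic.exists_quadratic hsymm hnondeg hU hperp
    have h := TwoStepGroup.translates_of_periodic hlog hper hφγ
    obtain ⟨hspeed, hlie⟩ := TwoStepGroup.translates_invariants hsymm hU hc hcw hlog hvel h
    obtain ⟨u, hu, z, hz, v, hv, hφ⟩ :=
      TwoStepGroup.exists_decomposition hsymm hnondeg hV hE (φ : TwoStepGroup 𝔫).log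
    refine ⟨hpos, u, hu, z, hz, v, hv, ⟨φ, φ.2, hφ⟩, fun y => ?_, ?_⟩
    · rw [← TwoStepGroup.form_lie_decomposition hU hu hz, ← hφ, hlie]
    · rw [← TwoStepGroup.form_decomposition_self hsymm hV hu hz hv, ← hφ, ← hspeed 0, abs_mul,
        hγ.unit_speed, one_mul, abs_sq]
  · rintro ⟨hpos, u, hu, z, hz, v, hv, ⟨φ, hφΓ, hφ⟩, hlie, hω⟩
    have hne : ω ≠ 0 := hpos.ne'
    rw [← TwoStepGroup.form_decomposition_self hsymm hV hu hz hv, ← hφ] at hω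
    have hφlie : ∀ y, B φ.log ⁅φ.log, y⁆ = 0 := fun y => by
      rw [hφ, TwoStepGroup.form_lie_decomposition hU hu hz, hlie]
    -- The one-parameter subgroup reaching φ at time ω; it has unit speed because ω² = |⟨log φ, log
    -- φ⟩|.
    have htrans := TwoStepGroup.translates_exp_smul (ω⁻¹ • φ.log) ω
    rw [smul_inv_smul₀ hne] at htrans
    simp only [TwoStepGroup.periodSpectrum, Set.mem_iUnion]
    refine ⟨ConjClasses.mk ⟨φ, hφΓ⟩, fun h => ?_, hpos, fun t => TwoStepGroup.exp (t • ω⁻¹ • φ.log),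
      ⟨TwoStepGroup.isGeodesic_exp_smul hsymm hU fun y => ?_, fun t => ?_⟩, fun t => ?_,
      ⟨φ, hφΓ⟩, rfl, ?_⟩
    -- A trivial class would force φ = 1, hence ω² = 0.
    · have h1 : φ = 1 := congrArg Subtype.val
        (show (⟨φ, hφΓ⟩ : Γ) = 1 from isConj_one_left.1 (ConjClasses.mk_eq_mk_iff_isConj.1 h))
      rw [h1, TwoStepGroup.log_one, map_zero, abs_zero] at hω
      exact hne (pow_eq_zero_iff two_ne_zero |>.1 hω)
    · simp [hφlie]
    · rw [TwoStepGroup.speedSq_exp_smul]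
      simp only [map_smul, LinearMap.smul_apply, smul_eq_mul, ← mul_assoc, abs_mul, ← hω,
        abs_of_pos (inv_pos.2 hpos)]
      field_simp
    · exact TwoStepGroup.proj_eq_iff.2 ⟨φ, hφΓ, htrans t⟩
    · have := htrans 0
      rw [zero_add] at this
      exact this.symm
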